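/- For a positive integer $r$ let $rK_2$ denote the matching with $r$ edges. Let $t\ge 2$ and let $r_1,\dots,r_t$ be positive integers. The Ramsey number $R(r_1K_2,\dots,r_tK_2)$ is the least $N$ such that every $t$-coloring of $E(K_N)$ contains, for some $i\in\{1,\dots,t\}$, a copy of $r_iK_2$ all of whose edges have color $i$. For a positive integer $n$ consider the following game of two players, Builder and Painter. Painter first picks a coloring $\chi\colon E(K_n)\to\{1,\dots,t\}$, which is hidden from Builder. In each round Builder queries an edge of $K_n$, possibly depending on the answers received so far, and Painter reveals its color. Builder wins as soon as, for some $i$, the edges queried so far contain a copy of $r_iK_2$ all of whose edges have color $i$. The restricted online Ramsey number $\widetilde R(r_1K_2,\dots,r_tK_2;n)$ is the least $\ell$ for which Builder has a strategy that, for every choice of $\chi$, wins with at most $\ell$ queries. **Theorem.** Let $t\ge 2$ and let $r_1,\dots,r_t$ be positive integers. If $n\ge R(r_1K_2,\dots,r_tK_2)$, then Builder can guarantee to win the game on $K_n$, and $$\widetilde R(r_1K_2,\dots,r_tK_2;n)\;\le\;\frac{2t-1+(t-3)\lg(t-2)}{t+1}\,n ,$$ where $\lg=\log_2$, with the convention $\lg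 0=0$. Moreover, the right-hand side is $O(n\log t)$: it is at most $C\,n\log t$ for an absolute constant $C>0$ that does not depend on $t$, $n$ or $r_1,\dots,r_t$. -/

import Mathlib

open scoped SimpleGraph

namespace OnlineRamsey

/-- The matching `r K₂`: vertex set `{0, …, r-1} × {0, 1}`, with exactly the `r` edges joining
`(j, 0)` to `(j, 1)`. -/
def matching (r : ℕ) : SimpleGraph (Fin r × Fin 2) where
  Adj x y := x.1 = y.1 ∧ x.2 ≠ y.2
  symm := ⟨fun _ _ h => ⟨h.1.symm, h.2.symm⟩⟩
  loopless := ⟨fun _ h => h.2 rfl⟩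

/-- Every `t`-coloring of the edges of `K_N` contains, for some `i`, a copy of `G i` in
color `i`. -/
def IsRamsey {t : ℕ} {W : Fin t → Type*} (G : ∀ i, SimpleGraph (W i)) (N : ℕ) : Prop :=
  ∀ χ : SimpleGraph.TopEdgeLabeling (Fin N) (Fin t), ∃ i, G i ⊑ χ.labelGraph i

/-- The Ramsey number `R(G_1, …, G_t)`: the least `N` with `IsRamsey G N` (`⊤` if there is none). -/
noncomputable def ramseyNumber {t : ℕ} {W : Fin t → Type*} (G : ∀ i, SimpleGraph (W i)) : ℕ∞ :=
  ⨅ (N : ℕ) (_ : IsRamsey G N), (N : ℕ∞)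

/-- A (deterministic, adaptive) strategy of Builder, where `E` is the set of edges and `K` the set
of colors: she either finishes, or queries an edge `e` and, when the color `c` of `e` has been
revealed, continues with the strategy `next c`. -/
inductive Strategy (E K : Type*) where
  | finish : Strategy E K
  | query (e : E) (next : K → Strategy E K) : Strategy E K

/-- The edges that Builder queries, in this order, when she plays a strategy and the coloring that
Painter has picked is `χ`. -/
def Strategy.queries {E K : Type*} : Strategy E K → (E → K) → List E
  | .finish, _ => []
  | .query e next, χ => e :: (next (χ e)).queries χ

/-- The graph formed by the exposed edges, when Builder plays `σ` against `χ`. -/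
def exposedGraph {V K : Type*} (σ : Strategy (⊤ : SimpleGraph V).edgeSet K)
    (χ : SimpleGraph.TopEdgeLabeling V K) : SimpleGraph V :=
  SimpleGraph.fromEdgeSet {e | ∃ h : e ∈ (⊤ : SimpleGraph V).edgeSet, ⟨e, h⟩ ∈ σ.queries χ}

/-- Builder can guarantee to win the game on `K_n` with at most `ℓ` queries: she has a strategy
which, whatever coloring Painter has picked, makes at most `ℓ` queries and exposes, for some `i`,
a copy of `G i` all of whose edges have color `i`. -/
def BuilderCanWin {t : ℕ} {W : Fin t → Type*} (G : ∀ i, SimpleGraph (W i)) (n ℓ : ℕ) : Prop :=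
  ∃ σ : Strategy (⊤ : SimpleGraph (Fin n)).edgeSet (Fin t),
    ∀ χ : SimpleGraph.TopEdgeLabeling (Fin n) (Fin t),
      (σ.queries χ).length ≤ ℓ ∧ ∃ i, G i ⊑ exposedGraph σ χ ⊓ χ.labelGraph i

/-- The restricted online Ramsey number of `G_1, …, G_t` on `K_n`: the least `ℓ` such that Builder
can guarantee to win with at most `ℓ` queries (`⊤` if there is none). -/
noncomputable def restrictedOnlineRamseyNumber {t : ℕ} {W : Fin t → Type*}
    (G : ∀ i, SimpleGraph (W i)) (n : ℕ) : ℕ∞ :=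
  ⨅ (ℓ : ℕ) (_ : BuilderCanWin G n ℓ), (ℓ : ℕ∞)

/-- `(2t - 1 + (t - 3) lg (t - 2)) / (t + 1)`, where `lg` is the logarithm to base `2` and
`lg 0 = 0` (which is also the value of `Real.logb 2 0`). -/
noncomputable def matchingConstant (t : ℕ) : ℝ :=
  (2 * (t : ℝ) - 1 + ((t : ℝ) - 3) * Real.logb 2 ((t : ℝ) - 2)) / ((t : ℝ) + 1)

end OnlineRamsey

/-!
Builder maintains vertex-disjoint trees whose edges she has queried, each of them properly
edge-colored by the answers, such that some color `b` occurs in all of them. As the colorings are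
proper, the edges of color `i` in all trees form a matching, of size `m i` say, and `m b` is at
least the number of trees. If the trees cover all of the `n` vertices but at most one, counting
vertices gives `n - 1 ≤ ∑ i, m i + m b`. On the other hand, `n ≥ R` implies
`n > ∑ i, (r i - 1) + r b` by the coloring of `not_isRamsey_matching`. So `m i ≥ r i` for some `i`
(`Position.hasMatching`).

As long as two vertices `u`, `v` are not covered, Builder queries `uv`. If its color `c` occurs in
all trees, then `uv` becomes a new tree, and `c` the common color. Otherwise `uv` is merged with a
tree that lacks `c` (`Tree.reach_extends`). To this end Builder queries edges between `{u, v}` and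
vertices `p` of the tree, using the ends `u` and `v` for the two sides of the tree as a bipartite
graph. If the color of the query at `p` does not occur at `p` in the tree, then the query can be
added to the tree (together with `uv`, unless its color is `c`, in which case it replaces `uv`).
Otherwise it is the color of an edge `pp'` of the tree, and `p` points to `p'`. If `p'` is a leaf,
then the query replaces `pp'`, so that `p'` is released. If `p'` points back to `p`, then `pp'` can
be replaced by the path formed by the two queries and `uv`. A binary search, in which each query is
made at a centroid of the remaining part of the tree and leads to a component with at most half of
the vertices, finds such a situation (`Tree.reach_extends_of_boundary`): it starts with the tree
without two of its leaves, and so needs at most `1 + ⌊log₂ (N - 1)⌋` queries for a tree with `N`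
edges.

Each merging yields a tree with more colors. Hence a tree with `N` edges and `k` colors has cost at
most `potential t N k` queries (`potential_step`), which is at most `matchingConstant t` for each
of its `N + 1` vertices (`potential_le`).
-/

namespace OnlineRamsey

/-! ### Queries as a forcing relation -/

/-- Builder, having made `j` queries and knowing the set `I` of pairs (edge, color), can reach a
position whose query count and knowledge satisfy `P`, whatever answers she gets. The answers are
not required to be consistent with each other. -/
inductive Reach {V K : Type*} (P : ℕ → Set (Sym2 V × K) → Prop) : ℕ → Set (Sym2 V × K) → Prop
  | done {j : ℕ} {I : Set (Sym2 V × K)} : P j I → Reach P j I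
  | query {j : ℕ} {I : Set (Sym2 V × K)} (x y : V) (hxy : x ≠ y) :
      (∀ c, Reach P (j + 1) (insert (s(x, y), c) I)) → Reach P j I

theorem Reach.bind {V K : Type*} {P Q : ℕ → Set (Sym2 V × K) → Prop} {j : ℕ}
    {I : Set (Sym2 V × K)} (h : Reach P j I) :
    (∀ j' I', I ⊆ I' → P j' I' → Reach Q j' I') → Reach Q j I := by
  induction h with
  | done h => exact fun hQ => hQ _ _ subset_rfl h
  | query x y hxy _ ih =>
    exact fun hQ => .query x y hxy fun c =>
      ih c fun j' I' hI => hQ j' I' ((Set.subset_insert _ _).trans hI)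

/-- The pairs (edge, color) that Builder learns when she plays `σ` against `χ`. -/
def answers {V K : Type*} (σ : Strategy (⊤ : SimpleGraph V).edgeSet K)
    (χ : SimpleGraph.TopEdgeLabeling V K) : Set (Sym2 V × K) :=
  {q | ∃ h : q.1 ∈ (⊤ : SimpleGraph V).edgeSet, ⟨q.1, h⟩ ∈ σ.queries χ ∧ χ ⟨q.1, h⟩ = q.2}

/-- Since `Reach` allows every sequence of answers, it provides a strategy that works against every
coloring. -/
theorem Reach.exists_strategy {V K : Type*} {P : ℕ → Set (Sym2 V × K) → Prop} {j : ℕ}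
    {I : Set (Sym2 V × K)} (h : Reach P j I) :
    ∃ σ : Strategy (⊤ : SimpleGraph V).edgeSet K, ∀ χ : SimpleGraph.TopEdgeLabeling V K,
      P (j + (σ.queries χ).length) (I ∪ answers σ χ) := by
  induction h with
  | @done j I h =>
    refine ⟨.finish, fun χ => ?_⟩
    have : answers (.finish : Strategy (⊤ : SimpleGraph V).edgeSet K) χ = ∅ := by
      ext q; simp [answers, Strategy.queries]
    simpa [this, Strategy.queries] using h
  | @query j I x y hxy _ ih =>
    choose next hnext using ih
    have he : s(x, y) ∈ (⊤ : SimpleGraph V).edgeSet := by simpa using hxy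
    refine ⟨.query ⟨s(x, y), he⟩ next, fun χ => ?_⟩
    have h1 := hnext (χ ⟨s(x, y), he⟩) χ
    have h2 : I ∪ answers (.query ⟨s(x, y), he⟩ next) χ =
        insert (s(x, y), χ ⟨s(x, y), he⟩) I ∪ answers (next (χ ⟨s(x, y), he⟩)) χ := by
      ext ⟨e, c⟩
      simp only [answers, Strategy.queries, Set.mem_union, Set.mem_ofPred_eq, List.mem_cons,
        Set.mem_insert_iff, Prod.mk.injEq, Subtype.mk.injEq]
      constructor
      · rintro (h | ⟨h, rfl | h', h''⟩)
        · exact .inl (.inr h)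
        · exact .inl (.inl ⟨rfl, h''.symm⟩)
        · exact .inr ⟨h, h', h''⟩
      · rintro ((⟨rfl, rfl⟩ | h) | ⟨h, h', h''⟩)
        · exact .inr ⟨he, .inl rfl, rfl⟩
        · exact .inl h
        · exact .inr ⟨h, .inr h', h''⟩
    rw [h2]
    simpa [Strategy.queries, add_assoc, add_comm, add_left_comm] using h1

/-- The knowledge `I` contains a matching of `r i` edges of color `i`, for some `i`. -/
def HasMatching {V : Type*} {t : ℕ} (r : Fin t → ℕ) (I : Set (Sym2 V × Fin t)) : Prop :=
  ∃ i, ∃ g : Fin (r i) × Fin 2 → V, Function.Injective g ∧ ∀ a, (s(g (a, 0), g (a, 1)), i) ∈ I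

theorem builderCanWin_of_reach {t n : ℕ} {r : Fin t → ℕ} {ℓ : ℕ}
    (h : Reach (V := Fin n) (K := Fin t) (fun j I => j ≤ ℓ ∧ HasMatching r I) 0 ∅) :
    BuilderCanWin (fun i => matching (r i)) n ℓ := by
  obtain ⟨σ, hσ⟩ := h.exists_strategy
  refine ⟨σ, fun χ => ?_⟩
  obtain ⟨hℓ, i, g, hg, hI⟩ := hσ χ
  refine ⟨by simpa using hℓ, i, ⟨⟨⟨g, ?_⟩, hg⟩⟩⟩
  have key : ∀ a, (exposedGraph σ χ ⊓ χ.labelGraph i).Adj (g (a, 0)) (g (a, 1)) := by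
    intro a
    have hne : g (a, 0) ≠ g (a, 1) := fun h => by simpa using hg h
    obtain ⟨h1, h2, h3⟩ := (by simpa using hI a : (s(g (a, 0), g (a, 1)), i) ∈ answers σ χ)
    refine ⟨?_, ?_⟩
    · simp only [exposedGraph, SimpleGraph.fromEdgeSet_adj, Set.mem_ofPred_eq]
      exact ⟨⟨h1, h2⟩, hne⟩
    · simp only [SimpleGraph.EdgeLabeling.labelGraph_adj]
      exact ⟨by simpa using hne, h3⟩
  rintro ⟨a, p⟩ ⟨b, q⟩ ⟨rfl, hpq⟩
  fin_cases p <;> fin_cases q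
  · exact absurd rfl hpq
  · exact key a
  · exact (key a).symm
  · exact absurd rfl hpq

/-! ### Properly edge-colored planted trees -/

/-- A properly edge-colored tree with a root of degree one. The vertices other than the root are
those of `N`, and each `x ∈ N` stands for the edge from `x` to its parent `par x`, of color
`col x`. The function `rank` increases away from the root (by an arbitrary amount), which rules out
cycles, and `side` is a proper 2-coloring of the vertices. -/
structure Tree (V K : Type*) [DecidableEq V] where
  N : Finset V
  root : V
  top : V
  par : V → V
  col : V → K
  rank : V → ℕ
  side : V → Bool
  root_notMem : root ∉ N
  top_mem : top ∈ N
  par_mem : ∀ x ∈ N, par x = root ∨ par x ∈ N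
  par_eq_root : ∀ x ∈ N, par x = root ↔ x = top
  rank_par : ∀ x ∈ N, rank (par x) < rank x
  side_par : ∀ x ∈ N, side (par x) = !side x
  proper : ∀ x ∈ N, ∀ y ∈ N, x ≠ y → col x = col y → x ≠ par y ∧ par x ≠ par y

namespace Tree

variable {V K : Type*} [DecidableEq V]

/-- All vertices of the tree, including the root. -/
def verts (B : Tree V K) : Finset V := insert B.root B.N

/-- All edges of the tree, with their colors, belong to the knowledge `I`. -/
def Known (B : Tree V K) (I : Set (Sym2 V × K)) : Prop := ∀ x ∈ B.N, (s(x, B.par x), B.col x) ∈ I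

theorem Known.mono {B : Tree V K} {I J : Set (Sym2 V × K)} (h : B.Known I) (hIJ : I ⊆ J) :
    B.Known J := fun x hx => hIJ (h x hx)

theorem par_mem_verts (B : Tree V K) {x : V} (hx : x ∈ B.N) : B.par x ∈ B.verts := by
  rcases B.par_mem x hx with h | h <;> simp [verts, h]

theorem mem_verts_of_mem (B : Tree V K) {x : V} (hx : x ∈ B.N) : x ∈ B.verts := by
  simp [verts, hx]

theorem par_ne (B : Tree V K) {x : V} (hx : x ∈ B.N) : B.par x ≠ x := fun h => by
  have := B.rank_par x hx
  rw [h] at this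
  exact lt_irrefl _ this

theorem card_verts (B : Tree V K) : B.verts.card = B.N.card + 1 :=
  Finset.card_insert_of_notMem B.root_notMem

/-- The colors of the edges of the tree. -/
def colors [DecidableEq K] (B : Tree V K) : Finset K := B.N.image B.col

theorem col_mem_colors [DecidableEq K] (B : Tree V K) {x : V} (hx : x ∈ B.N) : B.col x ∈ B.colors :=
  Finset.mem_image_of_mem _ hx

/-- The tree with the single edge `uv`. -/
def single (u v : V) (c : K) (huv : u ≠ v) : Tree V K where
  N := {v}
  root := u
  top := v
  par _ := u
  col _ := c
  rank x := if x = v then 1 else 0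
  side x := decide (x = v)
  root_notMem := by simpa using huv
  top_mem := by simp
  par_mem := by simp
  par_eq_root := by simp
  rank_par := by simp [huv]
  side_par := by simp [huv]
  proper := by simp +contextual

/-- Attach a new leaf `z` to the vertex `p`, by an edge of color `c`. -/
def attach (B : Tree V K) (p z : V) (c : K) (hp : p ∈ B.N) (hz : z ∉ B.verts)
    (hc : ∀ x ∈ B.N, x = p ∨ B.par x = p → B.col x ≠ c) : Tree V K where
  N := insert z B.N
  root := B.root
  top := B.top
  par x := if x = z then p else B.par x
  col x := if x = z then c else B.col x
  rank x := if x = z then B.rank p + 1 else B.rank x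
  side x := if x = z then !B.side p else B.side x
  root_notMem := by have := B.root_notMem; simp only [verts] at hz; grind
  top_mem := by have := B.top_mem; grind
  par_mem := by have := B.par_mem; grind
  par_eq_root := by
    have := B.par_eq_root; have := B.root_notMem; have := B.top_mem; simp only [verts] at hz; grind
  rank_par := by
    have := B.rank_par; have := @B.par_mem_verts; have := @B.mem_verts_of_mem; grind
  side_par := by
    have := B.side_par; have := @B.par_mem_verts; have := @B.mem_verts_of_mem; grind
  proper := by
    have := B.proper; have := @B.par_mem_verts; have := @B.mem_verts_of_mem; grind

/-- Remove the leaf `q`, which is not the only neighbor of the root. -/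
def remove (B : Tree V K) (q : V) (hq : q ≠ B.top) (hleaf : ∀ x ∈ B.N, B.par x ≠ q) :
    Tree V K where
  N := B.N.erase q
  root := B.root
  top := B.top
  par := B.par
  col := B.col
  rank := B.rank
  side := B.side
  root_notMem := by simp [B.root_notMem]
  top_mem := by simp [B.top_mem, hq.symm]
  par_mem := by have := B.par_mem; grind
  par_eq_root := by have := B.par_eq_root; grind
  rank_par := by have := B.rank_par; grind
  side_par := by have := B.side_par; grind
  proper := by have := B.proper; grind

/-- Replace the root by the path `z`, `w`, where `z` becomes adjacent to `top` and `w` becomes the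
new root. The edge `zw` has color `c`, and the edge from `top` to `z` keeps the color of the edge
from `top` to the old root. -/
def replaceRoot (B : Tree V K) (z w : V) (c : K) (hz : z ∉ B.verts) (hw : w ∉ B.verts)
    (hzw : z ≠ w) (hc : ∀ x ∈ B.N, B.col x ≠ c) : Tree V K where
  N := insert z B.N
  root := w
  top := z
  par x := if x = z then w else if x = B.top then z else B.par x
  col x := if x = z then c else B.col x
  rank x := if x = w then 0 else if x = z then 1 else B.rank x + 2
  side x := if x = w then B.side B.top else if x = z then !B.side B.top else B.side x
  root_notMem := by have := @B.mem_verts_of_mem; grind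
  top_mem := by simp
  par_mem := by have := B.par_mem; have := B.par_eq_root; grind
  par_eq_root := by
    have := @B.par_mem_verts; grind
  rank_par := by
    have := B.rank_par; have := @B.par_mem_verts; have := @B.mem_verts_of_mem; grind
  side_par := by
    have := B.side_par; have := @B.par_mem_verts; have := @B.mem_verts_of_mem; grind
  proper := by
    have := B.proper; have := @B.par_mem_verts; have := @B.mem_verts_of_mem; grind

/-- Replace the edge from `q` to its parent, of color `d`, by the path `par q`, `z`, `w`, `q`,
whose edges have the colors `d`, `c`, `d`. -/
def subdivide (B : Tree V K) (q z w : V) (c : K) (hq : q ∈ B.N) (hpq : B.par q ∈ B.N)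
    (hz : z ∉ B.verts) (hw : w ∉ B.verts) (hzw : z ≠ w) (hc : ∀ x ∈ B.N, B.col x ≠ c) :
    Tree V K where
  N := insert z (insert w B.N)
  root := B.root
  top := B.top
  par x := if x = z then B.par q else if x = w then z else if x = q then w else B.par x
  col x := if x = z then B.col q else if x = w then c else B.col x
  rank x := if x = z then 3 * B.rank (B.par q) + 1 else if x = w then 3 * B.rank (B.par q) + 2
    else 3 * B.rank x
  side x := if x = z then B.side q else if x = w then !B.side q else B.side x
  root_notMem := by have := B.root_notMem; simp only [verts] at hz hw; grind
  top_mem := by have := B.top_mem; grind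
  par_mem := by have := B.par_mem; grind
  par_eq_root := by
    have := B.par_eq_root; have := B.root_notMem; have := B.top_mem
    simp only [verts] at hz hw; grind
  rank_par := by
    have := B.rank_par; have := @B.par_mem_verts; have := @B.mem_verts_of_mem; grind
  side_par := by
    have := B.side_par; have := @B.par_mem_verts; have := @B.mem_verts_of_mem; grind
  proper := by
    have hp := B.proper
    have hpar := @B.par_mem_verts
    have hmem := @B.mem_verts_of_mem
    have hqn := B.par_ne hq
    have hzN : z ∉ B.N := fun h => hz (hmem h)
    have hwN : w ∉ B.N := fun h => hw (hmem h)
    have hzp : ∀ x ∈ B.N, B.par x ≠ z := fun x hx h => hz (h ▸ hpar hx)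
    have hwp : ∀ x ∈ B.N, B.par x ≠ w := fun x hx h => hw (h ▸ hpar hx)
    have hqp := hp q hq
    have hqp' := fun x hx => hp x hx q hq
    intro x hx y hy hxy
    have hpxy := fun hx hy => hp x hx y hy hxy
    rw [Finset.mem_insert, Finset.mem_insert] at hx hy
    clear hp hpar hmem
    rcases hx with rfl | rfl | hx <;> rcases hy with rfl | rfl | hy <;> grind

/-! ### Descendants -/

/-- `B.Desc a x`: the vertex `x` is a descendant of `a` (possibly `a` itself). -/
def Desc (B : Tree V K) (a x : V) : Prop :=
  Relation.ReflTransGen (fun x y => x ∈ B.N ∧ B.par x = y) x a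

theorem desc_refl (B : Tree V K) (a : V) : B.Desc a a := Relation.ReflTransGen.refl

theorem desc_of_par (B : Tree V K) {a x : V} (hx : x ∈ B.N) (h : B.Desc a (B.par x)) :
    B.Desc a x := Relation.ReflTransGen.head ⟨hx, rfl⟩ h

theorem Desc.cases {B : Tree V K} {a x : V} (h : B.Desc a x) :
    x = a ∨ x ∈ B.N ∧ B.Desc a (B.par x) := by
  rcases Relation.ReflTransGen.cases_head h with h | ⟨y, ⟨hx, rfl⟩, h⟩
  · exact .inl h
  · exact .inr ⟨hx, h⟩

theorem Desc.trans {B : Tree V K} {a b x : V} (hab : B.Desc a b) (hbx : B.Desc b x) :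
    B.Desc a x := Relation.ReflTransGen.trans hbx hab

theorem Desc.eq_or_rank_lt {B : Tree V K} {a x : V} (h : B.Desc a x) :
    x = a ∨ B.rank a < B.rank x := by
  induction h using Relation.ReflTransGen.head_induction_on with
  | refl => exact .inl rfl
  | @head x y hxy _ ih =>
    obtain ⟨hx, rfl⟩ := hxy
    have := B.rank_par x hx
    rcases ih with h | h
    · rw [h] at this; exact .inr this
    · exact .inr (h.trans this)

theorem not_desc_par (B : Tree V K) {x : V} (hx : x ∈ B.N) : ¬ B.Desc x (B.par x) := fun h => by
  have := B.rank_par x hx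
  rcases h.eq_or_rank_lt with h | h
  · exact B.par_ne hx h
  · omega

theorem desc_top (B : Tree V K) {x : V} (hx : x ∈ B.N) : B.Desc B.top x := by
  induction h : B.rank x using Nat.strong_induction_on generalizing x with
  | _ n ih =>
    subst h
    rcases B.par_mem x hx with h | h
    · rw [(B.par_eq_root x hx).1 h]; exact B.desc_refl _
    · exact B.desc_of_par hx (ih _ (B.rank_par x hx) h rfl)

open Classical in
/-- A centroid: `p ∈ S` such that, for every child `q ∈ S` of `p`, at most half of the vertices of
`S` descend from `q`, and less than half do not descend from `p`. It is a vertex of `S` from which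
more than half of `S` descends, with as few descendants in `S` as possible. -/
theorem exists_centroid (B : Tree V K) (S : Finset V) (hS : S ⊆ B.N) {a : V} (ha : a ∈ S)
    (haS : ∀ x ∈ S, B.Desc a x) :
    ∃ p ∈ S, 2 * (S.filter fun x => ¬ B.Desc p x).card < S.card ∧
      ∀ q ∈ S, B.par q = p → 2 * (S.filter fun x => B.Desc q x).card ≤ S.card := by
  let T := S.filter fun p => S.card < 2 * (S.filter fun x => B.Desc p x).card
  have haT : a ∈ T := by
    have h1 : (S.filter fun x => B.Desc a x) = S := Finset.filter_true_of_mem haS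
    have h2 : 0 < S.card := Finset.card_pos.2 ⟨a, ha⟩
    simp only [T, Finset.mem_filter, h1]
    exact ⟨ha, by omega⟩
  obtain ⟨p, hpT, hmin⟩ :=
    T.exists_min_image (fun p => (S.filter fun x => B.Desc p x).card) ⟨a, haT⟩
  obtain ⟨hpS, hp⟩ := Finset.mem_filter.1 hpT
  refine ⟨p, hpS, ?_, ?_⟩
  · have := Finset.card_filter_add_card_filter_not (s := S) (fun x => B.Desc p x)
    omega
  · rintro q hqS rfl
    by_contra! hlt
    have := hmin q (Finset.mem_filter.2 ⟨hqS, hlt⟩)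
    refine absurd (Finset.card_lt_card ?_) this.not_gt
    refine ⟨fun x hx => ?_, fun h => ?_⟩
    · rw [Finset.mem_filter] at hx ⊢
      exact ⟨hx.1, (B.desc_of_par (hS hqS) (B.desc_refl _)).trans hx.2⟩
    · exact B.not_desc_par (hS hqS)
        (Finset.mem_filter.1 (h (Finset.mem_filter.2 ⟨hpS, B.desc_refl _⟩))).2

/-! ### Surgery on known trees -/

variable [DecidableEq K]

theorem exists_attach (B : Tree V K) {p z : V} {c : K} {I : Set (Sym2 V × K)} (hI : B.Known I)
    (hp : p ∈ B.N) (hz : z ∉ B.verts) (hc : ∀ x ∈ B.N, x = p ∨ B.par x = p → B.col x ≠ c)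
    (hzp : (s(z, p), c) ∈ I) :
    ∃ B' : Tree V K, B'.Known I ∧ B'.N = insert z B.N ∧ B'.verts = insert z B.verts ∧
      B'.colors = insert c B.colors ∧ (∀ x ∈ B'.N, x = z ∨ B'.par x = z → B'.col x = c) := by
  have hmem := @B.mem_verts_of_mem
  have hpar := @B.par_mem_verts
  refine ⟨B.attach p z c hp hz hc, ?_, rfl, ?_, ?_, ?_⟩
  · intro x hx
    simp only [attach, Finset.mem_insert] at hx ⊢
    have := hI x
    grind
  · simp [verts, attach, Finset.insert_comm]
  · ext k
    simp only [colors, attach, Finset.mem_image, Finset.mem_insert]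
    grind
  · intro x hx
    simp only [attach, Finset.mem_insert] at hx ⊢
    grind

/-- Attach the path `p`, `z`, `w` to the vertex `p`. -/
theorem exists_graft (B : Tree V K) {p z w : V} {c d : K} {I : Set (Sym2 V × K)} (hI : B.Known I)
    (hp : p ∈ B.N) (hz : z ∉ B.verts) (hw : w ∉ B.verts) (hzw : z ≠ w)
    (hd : ∀ x ∈ B.N, x = p ∨ B.par x = p → B.col x ≠ d) (hdc : d ≠ c)
    (hzp : (s(z, p), d) ∈ I) (hwz : (s(z, w), c) ∈ I) :
    ∃ B' : Tree V K, B'.Known I ∧ B'.verts = insert w (insert z B.verts) ∧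
      B'.colors = insert c (insert d B.colors) ∧ B'.N.card = B.N.card + 2 := by
  obtain ⟨B₁, h1, h2, h3, h4, h5⟩ := B.exists_attach hI hp hz hd hzp
  obtain ⟨B₂, g1, g2, g3, g4, -⟩ := B₁.exists_attach (p := z) (z := w) (c := c) h1
    (by simp [h2]) (by simp [h3, hw, hzw.symm])
    (fun x hx hx' => by rw [h5 x hx hx']; exact hdc) (by rwa [Sym2.eq_swap])
  refine ⟨B₂, g1, by rw [g3, h3], by rw [g4, h4], ?_⟩
  have hzN : z ∉ B.N := fun h => hz (B.mem_verts_of_mem h)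
  have hwN : w ∉ B.N := fun h => hw (B.mem_verts_of_mem h)
  rw [g2, h2, Finset.card_insert_of_notMem (by simp [hwN, hzw.symm]),
    Finset.card_insert_of_notMem hzN]

theorem exists_replaceRoot (B : Tree V K) {z w : V} {c : K} {I : Set (Sym2 V × K)}
    (hI : B.Known I) (hz : z ∉ B.verts) (hw : w ∉ B.verts) (hzw : z ≠ w)
    (hc : ∀ x ∈ B.N, B.col x ≠ c) (hzt : (s(z, B.top), B.col B.top) ∈ I)
    (hwz : (s(z, w), c) ∈ I) :
    ∃ B' : Tree V K, B'.Known I ∧ B'.verts ⊆ insert w (insert z B.verts) ∧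
      B'.colors = insert c B.colors ∧ B'.N.card = B.N.card + 1 := by
  have hzN : z ∉ B.N := fun h => hz (B.mem_verts_of_mem h)
  refine ⟨B.replaceRoot z w c hz hw hzw hc, ?_, ?_, ?_, Finset.card_insert_of_notMem hzN⟩
  · intro x hx
    simp only [replaceRoot, Finset.mem_insert] at hx ⊢
    have := hI x
    grind
  · simp only [verts, replaceRoot]
    grind
  · ext k
    simp only [colors, replaceRoot, Finset.mem_image, Finset.mem_insert]
    grind

theorem exists_subdivide (B : Tree V K) {q z w : V} {c : K} {I : Set (Sym2 V × K)}
    (hI : B.Known I) (hq : q ∈ B.N) (hpq : B.par q ∈ B.N) (hz : z ∉ B.verts) (hw : w ∉ B.verts)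
    (hzw : z ≠ w) (hc : ∀ x ∈ B.N, B.col x ≠ c) (hzp : (s(z, B.par q), B.col q) ∈ I)
    (hwq : (s(w, q), B.col q) ∈ I) (hwz : (s(z, w), c) ∈ I) :
    ∃ B' : Tree V K, B'.Known I ∧ B'.verts = insert w (insert z B.verts) ∧
      B'.colors = insert c B.colors ∧ B'.N.card = B.N.card + 2 := by
  have hzN : z ∉ B.N := fun h => hz (B.mem_verts_of_mem h)
  have hwN : w ∉ B.N := fun h => hw (B.mem_verts_of_mem h)
  refine ⟨B.subdivide q z w c hq hpq hz hw hzw hc, ?_, ?_, ?_, ?_⟩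
  · intro x hx
    simp only [subdivide, Finset.mem_insert] at hx ⊢
    have := hI x
    grind
  · simp only [verts, subdivide]
    grind
  · ext k
    simp only [colors, subdivide, Finset.mem_image, Finset.mem_insert]
    grind
  · simp only [subdivide]
    rw [Finset.card_insert_of_notMem (by simp [hzN, hzw]), Finset.card_insert_of_notMem hwN]

/-- The outcome of merging `B` with the edge `uv` of color `c`. Either the tree grows by one vertex
and one color, so that one vertex is released, or it absorbs two vertices. -/
structure Extends (B : Tree V K) (c : K) (u v : V) (B' : Tree V K) : Prop where
  verts_subset : B'.verts ⊆ insert u (insert v B.verts)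
  subset_colors : insert c B.colors ⊆ B'.colors
  card : (B'.N.card = B.N.card + 1 ∧ B'.colors.card = B.colors.card + 1) ∨
    (B'.N.card = B.N.card + 2 ∧ (B'.colors.card = B.colors.card + 2 ∨
      B'.colors.card = B.colors.card + 1 ∧ 2 ≤ B.colors.card))

/-! ### Merging a tree with an edge -/

/-- The end of the edge `uv` from which the vertex `x` of the tree is queried. The ends of an edge
of the tree are queried from different ends of `uv`. -/
def probe (B : Tree V K) (u v x : V) : V := if B.side x then u else v

/-- The binary search. Every vertex of `S` that is adjacent to a vertex `y` outside `S` is joined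
to it by an edge whose color is also that of the query at `y`, unless `y` is a leaf of the tree.
Thus, if the query at a vertex `p ∈ S` shows the color of an edge between `p` and a vertex outside
`S`, then `B` can be extended. If it shows the color of an edge from `p` to another vertex of `S`,
the search goes on in the part of `S` beyond that edge. All other answers extend `B` at once. -/
theorem reach_extends_of_boundary (B : Tree V K) {c : K} {u v : V} (hu : u ∉ B.verts)
    (hv : v ∉ B.verts) (huv : u ≠ v) (hc : c ∉ B.colors) (n : ℕ) :
    ∀ (S : Finset V) (j : ℕ) (I : Set (Sym2 V × K)), B.Known I → (s(u, v), c) ∈ I → S ⊆ B.N →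
      (∃ a ∈ S, ∀ x ∈ S, B.Desc a x) →
      (∀ x ∈ S, B.par x ∉ S → B.par x = B.root ∨
        (s(B.probe u v (B.par x), B.par x), B.col x) ∈ I) →
      (∀ y ∈ B.N, y ∉ S → B.par y ∈ S → (∀ x ∈ B.N, B.par x ≠ y) ∨
        (s(B.probe u v y, y), B.col y) ∈ I) →
      S.card < 2 ^ n →
      Reach (fun j' I' => j' ≤ j + n ∧ ∃ B' : Tree V K, B'.Known I' ∧ B.Extends c u v B') j I := by
  classical
  induction n with
  | zero =>
    rintro S j I - - - ⟨a, ha, -⟩ - - hcard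
    have := Finset.card_pos.2 ⟨a, ha⟩
    omega
  | succ n ih =>
    rintro S j I hI hcI hS ⟨a, ha, haS⟩ hup hdown hcard
    obtain ⟨p, hpS, hp1, hp2⟩ := B.exists_centroid S hS ha haS
    have hp := hS hpS
    have hcN : ∀ x ∈ B.N, B.col x ≠ c := fun x hx h => hc (h ▸ B.col_mem_colors hx)
    -- `z` is the end of `uv` from which `p` is queried, and `w` is the other one.
    obtain ⟨z, w, hzp, hz, hw, hzw, hzwI, hver, hadj⟩ : ∃ z w, B.probe u v p = z ∧ z ∉ B.verts ∧
        w ∉ B.verts ∧ z ≠ w ∧ (s(z, w), c) ∈ I ∧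
        insert w (insert z B.verts) = insert u (insert v B.verts) ∧
        ∀ y, B.side y = !B.side p → B.probe u v y = w := by
      by_cases h : B.side p
      · exact ⟨u, v, by simp [probe, h], hu, hv, huv, hcI, Finset.insert_comm _ _ _,
          fun y hy => by simp [probe, hy, h]⟩
      · exact ⟨v, u, by simp [probe, h], hv, hu, huv.symm, by rwa [Sym2.eq_swap], rfl,
          fun y hy => by simp [probe, hy, h]⟩
    refine .query z p (fun h => hz (h ▸ B.mem_verts_of_mem hp)) fun d => ?_
    set J := insert (s(z, p), d) I
    have hIJ : I ⊆ J := Set.subset_insert _ _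
    have hdJ : (s(z, p), d) ∈ J := Set.mem_insert _ _
    have hkJ : B.Known J := hI.mono hIJ
    -- It is enough to extend `B` at once or to go on with a set of at most half the size.
    have win : (∃ B' : Tree V K, B'.Known J ∧ B.Extends c u v B') →
        Reach (fun j' I' => j' ≤ j + (n + 1) ∧
          ∃ B' : Tree V K, B'.Known I' ∧ B.Extends c u v B') (j + 1) J :=
      fun h => .done ⟨by omega, h⟩
    have step : ∀ S' ⊆ S, (∃ a ∈ S', ∀ x ∈ S', B.Desc a x) → 2 * S'.card ≤ S.card →
        (∀ x ∈ S', B.par x ∉ S' → B.par x = B.root ∨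
          (s(B.probe u v (B.par x), B.par x), B.col x) ∈ J) →
        (∀ y ∈ B.N, y ∉ S' → B.par y ∈ S' → (∀ x ∈ B.N, B.par x ≠ y) ∨
          (s(B.probe u v y, y), B.col y) ∈ J) →
        Reach (fun j' I' => j' ≤ j + (n + 1) ∧
          ∃ B' : Tree V K, B'.Known I' ∧ B.Extends c u v B') (j + 1) J := by
      intro S' hS' ha' hc' hup' hdown'
      have h2 : (2 : ℕ) ^ (n + 1) = 2 * 2 ^ n := by ring
      exact (ih S' (j + 1) J hkJ (hIJ hcI) (hS'.trans hS) ha' hup' hdown' (by omega)).bind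
        fun j' I' _ h => .done ⟨by omega, h.2⟩
    have hcard2 : ∀ x ∈ B.N, ∀ y ∈ B.N, B.col x ≠ B.col y → 2 ≤ B.colors.card := by
      intro x hx y hy hxy
      have : ({B.col x, B.col y} : Finset K) ⊆ B.colors := by
        simp [Finset.insert_subset_iff, B.col_mem_colors hx, B.col_mem_colors hy]
      simpa [Finset.card_pair hxy] using Finset.card_le_card this
    by_cases hdc : d = c
    · subst hdc
      obtain ⟨B', h1, h2, h3, h4, -⟩ :=
        B.exists_attach hkJ hp hz (fun x hx _ => hcN x hx) hdJ
      refine win ⟨B', h1, ?_, h4.ge, .inl ⟨?_, ?_⟩⟩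
      · rw [h3, ← hver]; exact Finset.subset_insert _ _
      · rw [h2, Finset.card_insert_of_notMem fun h => hz (B.mem_verts_of_mem h)]
      · rw [h4, Finset.card_insert_of_notMem hc]
    by_cases hd : ∀ x ∈ B.N, x = p ∨ B.par x = p → B.col x ≠ d
    · obtain ⟨B', h1, h2, h3, h4⟩ := B.exists_graft hkJ hp hz hw hzw hd hdc hdJ (hIJ hzwI)
      refine win ⟨B', h1, (h2.trans hver).subset, ?_, .inr ⟨h4, ?_⟩⟩
      · rw [h3]; exact Finset.insert_subset_insert _ (Finset.subset_insert _ _)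
      · by_cases hdB : d ∈ B.colors
        · obtain ⟨y, hy, rfl⟩ := Finset.mem_image.1 hdB
          refine .inr ⟨?_, hcard2 p hp y hy (hd p hp (.inl rfl))⟩
          rw [h3, Finset.insert_eq_of_mem hdB, Finset.card_insert_of_notMem hc]
        · refine .inl ?_
          rw [h3, Finset.card_insert_of_notMem (by simp [Ne.symm hdc, hc]),
            Finset.card_insert_of_notMem hdB]
    push Not at hd
    obtain ⟨x, hx, rfl | rfl, rfl⟩ := hd
    · -- The answer points to the parent of `p`.
      by_cases hroot : B.par x = B.root
      · obtain rfl := (B.par_eq_root x hx).1 hroot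
        obtain ⟨B', h1, h2, h3, h4⟩ := B.exists_replaceRoot hkJ hz hw hzw hcN hdJ (hIJ hzwI)
        refine win ⟨B', h1, hver ▸ h2, h3.ge, .inl ⟨h4, ?_⟩⟩
        rw [h3, Finset.card_insert_of_notMem hc]
      have hpar : B.par x ∈ B.N := (B.par_mem x hx).resolve_left hroot
      by_cases hparS : B.par x ∈ S
      · refine step (S.filter fun y => ¬ B.Desc x y) (Finset.filter_subset _ _) ⟨a, ?_, ?_⟩ hp1.le
          ?_ ?_
        · refine Finset.mem_filter.2 ⟨ha, fun h => ?_⟩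
          have h1 := B.rank_par x hx
          rcases h.eq_or_rank_lt with rfl | h
          · exact B.not_desc_par hx (haS _ hparS)
          · rcases (haS x hpS).eq_or_rank_lt with rfl | h' <;> omega
        · exact fun y hy => haS y (Finset.mem_filter.1 hy).1
        · intro y hy hy'
          obtain ⟨hyS, hyx⟩ := Finset.mem_filter.1 hy
          have : B.par y ∉ S := fun h => hy' (Finset.mem_filter.2
            ⟨h, fun h' => hyx (B.desc_of_par (hS hyS) h')⟩)
          exact (hup y hyS this).imp_right fun h => hIJ h
        · intro y hy hyS' hyp
          obtain ⟨hyS, hyx⟩ := Finset.mem_filter.1 hyp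
          by_cases hyS1 : y ∈ S
          · have hyd : B.Desc x y := by
              by_contra h; exact hyS' (Finset.mem_filter.2 ⟨hyS1, h⟩)
            rcases hyd.cases with rfl | h
            · exact .inr (by rw [hzp]; exact hdJ)
            · exact absurd h.2 hyx
          · exact (hdown y hy hyS1 hyS).imp_right fun h => hIJ h
      · have hk := (hup x hpS hparS).resolve_left hroot
        rw [hadj _ (B.side_par x hx)] at hk
        obtain ⟨B', h1, h2, h3, h4⟩ := B.exists_subdivide hkJ hx hpar hw hz hzw.symm hcN
          (hIJ hk) hdJ (by rw [Sym2.eq_swap]; exact hIJ hzwI)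
        refine win ⟨B', h1, ?_, h3.ge, .inr ⟨h4, .inr ⟨?_, ?_⟩⟩⟩
        · rw [h2, Finset.insert_comm, hver]
        · rw [h3, Finset.card_insert_of_notMem hc]
        · exact hcard2 x hx _ hpar fun h =>
            (B.proper _ hpar x hx (B.par_ne hx) h.symm).1 rfl
    · -- The answer points to the child `x` of `p`.
      have hside : B.probe u v x = w := hadj x (by simp [B.side_par x hx])
      have hpx := B.par_ne hx
      by_cases hxS : x ∈ S
      · refine step (S.filter fun y => B.Desc x y) (Finset.filter_subset _ _)
          ⟨x, Finset.mem_filter.2 ⟨hxS, B.desc_refl x⟩, fun y hy => (Finset.mem_filter.1 hy).2⟩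
          (hp2 x hxS rfl) ?_ ?_
        · intro y hy hy'
          obtain ⟨hyS, hyx⟩ := Finset.mem_filter.1 hy
          by_cases hyS1 : B.par y ∈ S
          · have hyd : ¬ B.Desc x (B.par y) := fun h => hy' (Finset.mem_filter.2 ⟨hyS1, h⟩)
            rcases hyx.cases with rfl | h
            · exact .inr (by rw [hzp]; exact hdJ)
            · exact absurd h.2 hyd
          · exact (hup y hyS hyS1).imp_right fun h => hIJ h
        · intro y hy hyS' hyp
          obtain ⟨hyS, hyx⟩ := Finset.mem_filter.1 hyp
          have : y ∉ S := fun h => hyS' (Finset.mem_filter.2 ⟨h, B.desc_of_par hy hyx⟩)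
          exact (hdown y hy this hyS).imp_right fun h => hIJ h
      rcases hdown x hx hxS hpS with hleaf | hk
      · have hxtop : x ≠ B.top := by
          rintro rfl
          exact B.root_notMem ((B.par_eq_root _ hx).2 rfl ▸ hp)
        let B₁ := B.remove x hxtop hleaf
        have hB₁ : B₁.verts ⊆ B.verts := Finset.insert_subset_insert _ (Finset.erase_subset _ _)
        have hd₁ : ∀ y ∈ B₁.N, y = B.par x ∨ B.par y = B.par x → B.col y ≠ B.col x := by
          rintro y hy hyp hcol
          obtain ⟨hyx, hyN⟩ := Finset.mem_erase.1 hy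
          have := B.proper y hyN x hx hyx hcol
          rcases hyp with h | h
          · exact this.1 h
          · exact this.2 h
        obtain ⟨B', h1, h2, h3, h4⟩ := B₁.exists_graft (p := B.par x) (z := z) (w := w) (c := c)
          (d := B.col x) (I := J) (fun y hy => hkJ y (Finset.mem_of_mem_erase hy))
          (Finset.mem_erase.2 ⟨hpx, hp⟩) (fun h => hz (hB₁ h)) (fun h => hw (hB₁ h)) hzw hd₁
          hdc hdJ (hIJ hzwI)
        have hcol : B'.colors = insert c B.colors := by
          rw [h3]
          change insert c (insert (B.col x) ((B.N.erase x).image B.col)) =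
            insert c (B.N.image B.col)
          rw [← Finset.image_insert, Finset.insert_erase hx]
        have hN : B₁.N.card + 1 = B.N.card := Finset.card_erase_add_one hx
        refine win ⟨B', h1, ?_, hcol.ge, .inl ⟨by omega, ?_⟩⟩
        · rw [h2, ← hver]
          exact Finset.insert_subset_insert _ (Finset.insert_subset_insert _ hB₁)
        · rw [hcol, Finset.card_insert_of_notMem hc]
      · rw [hside] at hk
        obtain ⟨B', h1, h2, h3, h4⟩ := B.exists_subdivide hkJ hx hp hz hw hzw hcN hdJ
          (hIJ hk) (hIJ hzwI)
        refine win ⟨B', h1, ?_, h3.ge, .inr ⟨h4, .inr ⟨?_, ?_⟩⟩⟩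
        · rw [h2, hver]
        · rw [h3, Finset.card_insert_of_notMem hc]
        · exact hcard2 x hx _ hp fun h => (B.proper _ hp x hx hpx h.symm).1 rfl

/-- A tree with `N` edges, none of color `c`, can be merged with a disjoint edge of color `c` by
`1 + ⌊log₂ (N - 1)⌋` queries. -/
theorem reach_extends (B : Tree V K) {c : K} {u v : V} (hu : u ∉ B.verts)
    (hv : v ∉ B.verts) (huv : u ≠ v) (hc : c ∉ B.colors) {j : ℕ} {I : Set (Sym2 V × K)}
    (hI : B.Known I) (hcI : (s(u, v), c) ∈ I) :
    Reach (fun j' I' => j' ≤ j + (Nat.log 2 (B.N.card - 1) + 1) ∧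
      ∃ B' : Tree V K, B'.Known I' ∧ B.Extends c u v B') j I := by
  have htop := B.top_mem
  -- The search avoids the root and a vertex `x` of largest rank, which are leaves of the tree.
  obtain ⟨x, hx, hmax⟩ := B.N.exists_max_image B.rank ⟨_, htop⟩
  have hleaf : ∀ y ∈ B.N, B.par y ≠ x := by
    rintro y hy rfl
    have := hmax y hy
    have := B.rank_par y hy
    omega
  by_cases hone : x = B.top
  · have hN : B.N = {x} := by
      refine Finset.eq_singleton_iff_unique_mem.2 ⟨hx, fun y hy => ?_⟩
      rcases (B.desc_top hy).eq_or_rank_lt with h | h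
      · rw [h, hone]
      · have := hmax y hy
        rw [hone] at this
        omega
    have hroot : B.par x = B.root := (B.par_eq_root x hx).2 hone
    have := B.root_notMem
    refine B.reach_extends_of_boundary hu hv huv hc _ {x} j I hI hcI (by simp [hN])
      ⟨x, by simp [B.desc_refl]⟩ ?_ ?_ (by simp [hN])
    · simp [hroot]
    · intro y hy hy'
      exact absurd hy (by rwa [hN])
  · refine B.reach_extends_of_boundary hu hv huv hc _ (B.N.erase x) j I hI hcI
      (Finset.erase_subset _ _) ⟨B.top, Finset.mem_erase.2 ⟨Ne.symm hone, htop⟩,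
        fun y hy => B.desc_top (Finset.mem_of_mem_erase hy)⟩ ?_ ?_ ?_
    · intro y hy hy'
      obtain ⟨-, hyN⟩ := Finset.mem_erase.1 hy
      refine .inl ((B.par_mem y hyN).resolve_right fun h => hy' ?_)
      exact Finset.mem_erase.2 ⟨hleaf y hyN, h⟩
    · intro y hy hy' _
      obtain rfl : y = x := by
        by_contra h; exact hy' (Finset.mem_erase.2 ⟨h, hy⟩)
      exact .inl hleaf
    · rw [Finset.card_erase_of_mem hx]
      exact Nat.lt_pow_succ_log_self (by norm_num) _

end Tree

/-! ### The potential of a tree -/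

/-- The number of queries charged to a tree with `N` edges of `k` different colors, when there are
`t` colors. A color beyond the third costs `2 + ⌊log₂ (t - 2)⌋`; the last term pays for the
searches in trees with more than `t` vertices. -/
def potential (t N k : ℕ) : ℕ := 2 * k - 1 + (k - 3) * Nat.log 2 (t - 2) + (N - t)

/-- The numbers `N` of edges and `k` of colors that occur for the trees built by Builder. -/
def Admissible (N k : ℕ) : Prop := (N = 1 ∧ k = 1) ∨ (k ≤ N ∧ N + 2 ≤ 2 * k)

/-- Merging a tree with an edge, which takes one query for the edge and `1 + ⌊log₂ (N - 1)⌋` for the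
search, costs no more than the increase of the potential. -/
theorem potential_step {t N k N' k' : ℕ} (hk : k < t) (hk' : k' ≤ t) (h : Admissible N k)
    (h' : (N' = N + 1 ∧ k' = k + 1) ∨ (N' = N + 2 ∧ (k' = k + 2 ∨ k' = k + 1 ∧ 2 ≤ k))) :
    Admissible N' k' ∧ potential t N k + (Nat.log 2 (N - 1) + 2) ≤ potential t N' k' := by
  unfold Admissible at *
  refine ⟨by omega, ?_⟩
  unfold potential
  by_cases hk3 : k < 3
  · have hlog : Nat.log 2 (N - 1) = 0 := Nat.log_of_lt (by omega)
    have : (k - 3) * Nat.log 2 (t - 2) ≤ (k' - 3) * Nat.log 2 (t - 2) :=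
      Nat.mul_le_mul_right _ (by omega)
    omega
  · have hmul : (k - 3) * Nat.log 2 (t - 2) + Nat.log 2 (t - 2) ≤
        (k' - 3) * Nat.log 2 (t - 2) := by
      rw [← Nat.succ_mul]
      exact Nat.mul_le_mul_right _ (by omega)
    by_cases hN : N < t
    · have : Nat.log 2 (N - 1) ≤ Nat.log 2 (t - 2) := Nat.log_mono_right (by omega)
      omega
    · have : Nat.log 2 (N - 1) ≤ Nat.log 2 (t - 2) + 1 := by
        rw [← Nat.log_mul_base (by norm_num) (by omega)]
        exact Nat.log_mono_right (by omega)
      omega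

theorem mul_logb_nonneg {t : ℕ} (ht : 2 ≤ t) :
    0 ≤ ((t : ℝ) - 3) * Real.logb 2 ((t : ℝ) - 2) := by
  rcases ht.eq_or_lt with rfl | h
  · norm_num
  · have h3 : (3 : ℝ) ≤ t := by exact_mod_cast h
    exact mul_nonneg (by linarith) (Real.logb_nonneg (by norm_num) (by linarith))

theorem one_le_matchingConstant {t : ℕ} (ht : 2 ≤ t) : 1 ≤ matchingConstant t := by
  have h2 : (2 : ℝ) ≤ t := by exact_mod_cast ht
  unfold matchingConstant
  rw [le_div_iff₀ (by linarith)]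
  have := mul_logb_nonneg ht
  linarith

theorem potential_le {t N k : ℕ} (ht : 2 ≤ t) (hk : k ≤ t) (h : Admissible N k) :
    (potential t N k : ℝ) ≤ matchingConstant t * (N + 1) := by
  have h2 : (2 : ℝ) ≤ t := by exact_mod_cast ht
  have hkN : k ≤ N := by unfold Admissible at h; omega
  have hk1 : 1 ≤ k := by unfold Admissible at h; omega
  have hktR : (k : ℝ) ≤ t := by exact_mod_cast hk
  have hk1R : (1 : ℝ) ≤ k := by exact_mod_cast hk1
  have hkNR : (k : ℝ) ≤ N := by exact_mod_cast hkN
  have h1 := one_le_matchingConstant ht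
  -- The excess `N - k` of edges over colors is paid at the rate `1 ≤ matchingConstant t`.
  suffices hmain : ((2 * k - 1 + (k - 3) * Nat.log 2 (t - 2) : ℕ) : ℝ) ≤
      matchingConstant t * (k + 1) by
    have hsub : ((N - t : ℕ) : ℝ) ≤ N - k := by
      rw [← Nat.cast_sub hkN]; exact_mod_cast Nat.sub_le_sub_left hk N
    have : (N : ℝ) - k ≤ matchingConstant t * (N - k) := by nlinarith
    unfold potential
    push_cast at hmain ⊢
    linarith
  have hcast : ((2 * k - 1 : ℕ) : ℝ) = 2 * k - 1 := by
    rw [Nat.cast_sub (by omega)]; push_cast; ring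
  unfold matchingConstant
  rw [div_mul_eq_mul_div, le_div_iff₀ (by linarith)]
  rw [Nat.cast_add, Nat.cast_mul, hcast]
  have hbase : (2 * (k : ℝ) - 1) * (t + 1) ≤ (2 * t - 1) * (k + 1) := by nlinarith
  have hlog : ((k - 3 : ℕ) : ℝ) * (Nat.log 2 (t - 2) : ℝ) * (t + 1) ≤
      ((t : ℝ) - 3) * Real.logb 2 ((t : ℝ) - 2) * (k + 1) := by
    have hL := Real.natLog_le_logb (t - 2) 2
    push_cast [Nat.cast_sub ht] at hL
    by_cases hk3 : k ≤ 3
    · have := mul_logb_nonneg ht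
      rw [Nat.sub_eq_zero_of_le hk3]
      simp only [Nat.cast_zero, zero_mul]
      positivity
    · have hk3R : (3 : ℝ) ≤ k := by exact_mod_cast (by omega : 3 ≤ k)
      rw [Nat.cast_sub (by omega)]
      have h0 : (0 : ℝ) ≤ Nat.log 2 (t - 2) := Nat.cast_nonneg _
      have hcoef : ((k : ℝ) - 3) * (t + 1) ≤ (t - 3) * (k + 1) := by nlinarith
      calc ((k : ℝ) - (3 : ℕ)) * (Nat.log 2 (t - 2) : ℝ) * (t + 1)
          = ((k : ℝ) - 3) * (t + 1) * (Nat.log 2 (t - 2) : ℝ) := by push_cast; ring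
        _ ≤ ((t : ℝ) - 3) * (k + 1) * Real.logb 2 ((t : ℝ) - 2) := by gcongr; nlinarith
        _ = _ := by ring
  linarith

theorem matchingConstant_le {t : ℕ} (ht : 2 ≤ t) :
    matchingConstant t ≤ 3 / Real.log 2 * Real.log t := by
  have h2 : (2 : ℝ) ≤ t := by exact_mod_cast ht
  have hlog2 : 0 < Real.log 2 := Real.log_pos (by norm_num)
  have hlg : 3 / Real.log 2 * Real.log t = 3 * Real.logb 2 t := by
    rw [Real.logb]; ring
  have h1 : 1 ≤ Real.logb 2 t := by
    rw [Real.le_logb_iff_rpow_le (by norm_num) (by linarith)]; simpa using h2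
  rw [hlg]
  unfold matchingConstant
  rw [div_le_iff₀ (by linarith)]
  have : ((t : ℝ) - 3) * Real.logb 2 ((t : ℝ) - 2) ≤ (t + 1) * Real.logb 2 t := by
    rcases ht.eq_or_lt with rfl | h
    · norm_num
    · have h3 : (3 : ℝ) ≤ t := by exact_mod_cast h
      have hle : Real.logb 2 ((t : ℝ) - 2) ≤ Real.logb 2 t :=
        Real.logb_le_logb_of_le (by norm_num) (by linarith) (by linarith)
      have h0 : 0 ≤ Real.logb 2 ((t : ℝ) - 2) := Real.logb_nonneg (by norm_num) (by linarith)
      gcongr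
      linarith
  nlinarith

/-! ### The lower bound for the Ramsey number -/

/-- The lower bound of Cockayne and Lorimer: no number up to `∑ i, (r i - 1) + r b` has the Ramsey
property. -/
theorem not_isRamsey_matching {t N : ℕ} {r : Fin t → ℕ} (hr : ∀ i, 0 < r i) (b : Fin t)
    (hN : N ≤ ∑ i, (r i - 1) + r b) : ¬ IsRamsey (fun i => matching (r i)) N := by
  intro hR
  -- Label `r i - 1` vertices by each `i ≠ b` and `2 * r b - 1` vertices by `b`.
  let cap : Fin t → ℕ := fun i => (r i - 1) + if i = b then r b else 0
  have hcap : ∑ i, cap i = ∑ i, (r i - 1) + r b := by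
    simp [cap, Finset.sum_add_distrib]
  obtain ⟨φ⟩ : Nonempty (Fin N ↪ Σ i, Fin (cap i)) :=
    Function.Embedding.nonempty_of_card_le (by simpa [hcap] using hN)
  let f : Fin N → Fin t := fun x => (φ x).1
  have hfib : ∀ (i : Fin t) (α : Type) [Fintype α] (h : α → Fin N), Function.Injective h →
      (∀ a, f (h a) = i) → Fintype.card α ≤ cap i := by
    intro i α _ h hinj hf
    have h1 : ∀ a, ∃ y : Fin (cap i), φ (h a) = ⟨i, y⟩ := by
      intro a
      have := hf a
      rcases e : φ (h a) with ⟨i', y⟩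
      simp only [f, e] at this
      subst this
      exact ⟨y, rfl⟩
    choose y hy using h1
    have : Function.Injective y := fun a a' e => hinj (φ.injective (by rw [hy, hy, e]))
    simpa using Fintype.card_le_of_injective y this
  -- An edge with an end whose label is not `b` gets such a label as its color.
  let χ : SimpleGraph.TopEdgeLabeling (Fin N) (Fin t) := fun e =>
    Sym2.lift ⟨fun x y => if f (min x y) = b then f (max x y) else f (min x y),
      fun x y => by simp only [min_comm y x, max_comm y x]⟩ e.1
  have hχ : ∀ i x y, (χ.labelGraph i).Adj x y →
      (i ≠ b → f x = i ∨ f y = i) ∧ (i = b → f x = b ∧ f y = b) := by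
    intro i x y h
    rw [SimpleGraph.EdgeLabeling.labelGraph_adj] at h
    obtain ⟨_, h⟩ := h
    simp only [χ, Sym2.lift_mk] at h
    rcases le_total x y with hxy | hxy
    · rw [min_eq_left hxy, max_eq_right hxy] at h
      grind
    · rw [min_eq_right hxy, max_eq_left hxy] at h
      grind
  obtain ⟨i, ⟨g⟩⟩ := hR χ
  have hadj : ∀ a, (χ.labelGraph i).Adj (g (a, 0)) (g (a, 1)) := fun a =>
    g.toHom.map_adj ⟨rfl, by simp⟩
  have hri := hr i
  by_cases hi : i = b
  · have := hfib i (Fin (r i) × Fin 2) g g.injective (by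
      rintro ⟨a, p⟩
      have := (hχ i _ _ (hadj a)).2 hi
      fin_cases p
      · exact this.1.trans hi.symm
      · exact this.2.trans hi.symm)
    simp only [Fintype.card_prod, Fintype.card_fin, cap, ← hi, if_true] at this
    omega
  · have h1 : ∀ a, ∃ p, f (g (a, p)) = i := fun a =>
      ((hχ i _ _ (hadj a)).1 hi).elim (fun h => ⟨0, h⟩) fun h => ⟨1, h⟩
    choose p hp using h1
    have := hfib i (Fin (r i)) (fun a => g (a, p a))
      (fun a a' e => (Prod.mk.inj (g.injective e)).1) hp
    simp only [Fintype.card_fin, cap, if_neg hi] at this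
    omega

theorem lt_of_ramseyNumber_le {t n : ℕ} {r : Fin t → ℕ} (hr : ∀ i, 0 < r i)
    (h : ramseyNumber (fun i => matching (r i)) ≤ (n : ℕ∞)) (b : Fin t) :
    ∑ i, (r i - 1) + r b < n := by
  by_contra! hle
  have hlow : ((n + 1 : ℕ) : ℕ∞) ≤ ramseyNumber (fun i => matching (r i)) := by
    refine le_iInf₂ fun N hN => ?_
    have : ¬ N ≤ n := fun hNn => not_isRamsey_matching hr b (hNn.trans hle) hN
    exact_mod_cast (by omega : n + 1 ≤ N)
  have := hlow.trans h
  rw [Nat.cast_le] at this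
  omega

/-! ### Families of disjoint trees -/

variable {V K : Type*} [DecidableEq V]

/-- The vertices covered by the trees. -/
def covered (Bs : List (Tree V K)) : Finset V := Bs.foldr (fun B s => B.verts ∪ s) ∅

theorem covered_cons (B : Tree V K) (Bs : List (Tree V K)) :
    covered (B :: Bs) = B.verts ∪ covered Bs := rfl

theorem mem_covered {Bs : List (Tree V K)} {x : V} : x ∈ covered Bs ↔ ∃ B ∈ Bs, x ∈ B.verts := by
  induction Bs with
  | nil => simp [covered]
  | cons B Bs ih => simp [covered_cons, ih]

theorem disjoint_covered {B : Tree V K} {Bs : List (Tree V K)} :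
    Disjoint B.verts (covered Bs) ↔ ∀ A ∈ Bs, Disjoint B.verts A.verts := by
  simp only [Finset.disjoint_left, mem_covered]
  grind

theorem card_covered {Bs : List (Tree V K)}
    (h : Bs.Pairwise fun A B => Disjoint A.verts B.verts) :
    (covered Bs).card = (Bs.map fun B => B.N.card + 1).sum := by
  induction Bs with
  | nil => simp [covered]
  | cons B Bs ih =>
    rw [List.pairwise_cons] at h
    rw [covered_cons, Finset.card_union_of_disjoint (disjoint_covered.2 h.1), ih h.2, B.card_verts]
    simp

variable [DecidableEq K]

/-- The position between two rounds: vertex-disjoint known trees that share a color. -/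
structure Position (I : Set (Sym2 V × K)) (Bs : List (Tree V K)) : Prop where
  known : ∀ B ∈ Bs, B.Known I
  disjoint : Bs.Pairwise fun A B => Disjoint A.verts B.verts
  admissible : ∀ B ∈ Bs, Admissible B.N.card B.colors.card
  common : ∃ b, ∀ B ∈ Bs, b ∈ B.colors

/-- The number of queries charged to all trees. -/
def totalPotential (t : ℕ) (Bs : List (Tree V K)) : ℕ :=
  (Bs.map fun B => potential t B.N.card B.colors.card).sum

theorem Position.perm {I : Set (Sym2 V × K)} {Bs Bs' : List (Tree V K)} (h : Position I Bs)
    (hp : Bs.Perm Bs') : Position I Bs' where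
  known B hB := h.known B (hp.mem_iff.2 hB)
  disjoint := (hp.pairwise_iff fun h => h.symm).1 h.disjoint
  admissible B hB := h.admissible B (hp.mem_iff.2 hB)
  common := h.common.imp fun _ hb B hB => hb B (hp.mem_iff.2 hB)

theorem totalPotential_le [Fintype V] [Fintype K] {I : Set (Sym2 V × K)} {Bs : List (Tree V K)}
    (ht : 2 ≤ Fintype.card K) (h : Position I Bs) :
    (totalPotential (Fintype.card K) Bs : ℝ) ≤
      matchingConstant (Fintype.card K) * Fintype.card V := by
  have h1 : ((covered Bs).card : ℝ) ≤ Fintype.card V := by exact_mod_cast Finset.card_le_univ _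
  have h2 := one_le_matchingConstant ht
  refine le_trans ?_ (mul_le_mul_of_nonneg_left h1 (by linarith))
  rw [card_covered h.disjoint, totalPotential]
  have hadm := h.admissible
  clear h1 h
  induction Bs with
  | nil => simp
  | cons B Bs ih =>
    have h3 := ih fun A hA => hadm A (List.mem_cons_of_mem _ hA)
    have h4 := potential_le ht (Finset.card_le_univ B.colors) (hadm B List.mem_cons_self)
    simp only [List.map_cons, List.sum_cons]
    push_cast at h3 ⊢
    linarith

/-- Builder can cover all vertices but at most one by the trees of a position, with no more queries
than are charged to these trees. -/
theorem Position.reach [Fintype V] [Fintype K] (m : ℕ) : ∀ (Bs : List (Tree V K)) (j : ℕ)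
    (I : Set (Sym2 V × K)), Position I Bs → ((covered Bs)ᶜ).card = m →
    j ≤ totalPotential (Fintype.card K) Bs →
    Reach (fun j' I' => ∃ Bs', Position I' Bs' ∧ ((covered Bs')ᶜ).card ≤ 1 ∧
      j' ≤ totalPotential (Fintype.card K) Bs') j I := by
  induction m using Nat.strong_induction_on with
  | _ m ih =>
  intro Bs j I hpos hm hj
  by_cases hm1 : m ≤ 1
  · exact .done ⟨Bs, hpos, hm ▸ hm1, hj⟩
  obtain ⟨u, hu, v, hv, huv⟩ := Finset.one_lt_card.1 (by omega : 1 < ((covered Bs)ᶜ).card)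
  rw [Finset.mem_compl] at hu hv
  refine .query u v huv fun c => ?_
  set J := insert (s(u, v), c) I
  have hIJ : I ⊆ J := Set.subset_insert _ _
  have hcJ : (s(u, v), c) ∈ J := Set.mem_insert _ _
  by_cases hall : ∀ B ∈ Bs, c ∈ B.colors
  · -- All trees contain the color `c`, which becomes the common color.
    let B₀ : Tree V K := .single u v c huv
    have hv₀ : B₀.verts = {u, v} := rfl
    have hc₀ : B₀.colors = {c} := rfl
    have hN₀ : B₀.N.card = 1 := rfl
    have hpos' : Position J (B₀ :: Bs) := by
      refine ⟨?_, ?_, ?_, c, ?_⟩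
      · rw [List.forall_mem_cons]
        refine ⟨fun x hx => ?_, fun B hB => (hpos.known B hB).mono hIJ⟩
        obtain rfl : x = v := Finset.mem_singleton.1 hx
        change (s(x, u), c) ∈ J
        rwa [Sym2.eq_swap]
      · refine List.pairwise_cons.2 ⟨disjoint_covered.1 ?_, hpos.disjoint⟩
        simp [hv₀, hu, hv]
      · rw [List.forall_mem_cons]
        exact ⟨.inl ⟨hN₀, by simp [hc₀]⟩, hpos.admissible⟩
      · rw [List.forall_mem_cons]
        exact ⟨by simp [hc₀], hall⟩
    refine ih _ ?_ (B₀ :: Bs) (j + 1) J hpos' rfl ?_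
    · rw [← hm]
      refine Finset.card_lt_card (Finset.compl_ssubset_compl.2 ?_)
      rw [covered_cons, Finset.ssubset_iff_of_subset Finset.subset_union_right]
      exact ⟨u, by simp [hv₀], hu⟩
    · have : 1 ≤ potential (Fintype.card K) B₀.N.card B₀.colors.card := by
        simp [hN₀, hc₀, potential]
      simp only [totalPotential, List.map_cons, List.sum_cons] at hj ⊢
      omega
  · -- A tree `B` without the color `c` absorbs the edge, so the common color remains common.
    push Not at hall
    obtain ⟨B, hB, hcB⟩ := hall
    obtain ⟨l₁, l₂, rfl⟩ := List.append_of_mem hB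
    have hperm : (l₁ ++ B :: l₂).Perm (B :: (l₁ ++ l₂)) := List.perm_middle
    generalize l₁ ++ l₂ = rest at hperm
    have hcov : covered (l₁ ++ B :: l₂) = covered (B :: rest) := by
      ext x
      simp only [mem_covered, hperm.mem_iff]
    have htot : totalPotential (Fintype.card K) (l₁ ++ B :: l₂) =
        totalPotential (Fintype.card K) (B :: rest) := (hperm.map _).sum_eq
    rw [hcov, covered_cons, Finset.mem_union, not_or] at hu hv
    rw [hcov] at hm
    rw [htot] at hj
    replace hpos := hpos.perm hperm
    clear hcov htot hperm hB
    refine (B.reach_extends hu.1 hv.1 huv hcB ((hpos.known B List.mem_cons_self).mono hIJ)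
      hcJ (j := j + 1)).bind ?_
    rintro j' I' hJI' ⟨hj', B', hkB', hext⟩
    have hstep := potential_step (t := Fintype.card K) (Finset.card_lt_univ_of_notMem hcB)
      (Finset.card_le_univ B'.colors) (hpos.admissible B List.mem_cons_self) hext.card
    have hdis := List.pairwise_cons.1 hpos.disjoint
    have hdis' : Disjoint B'.verts (covered rest) := by
      refine Finset.disjoint_of_subset_left hext.verts_subset ?_
      simp [hu.2, hv.2, disjoint_covered.2 hdis.1]
    have hpos' : Position I' (B' :: rest) := by
      refine ⟨?_, List.pairwise_cons.2 ⟨disjoint_covered.1 hdis', hdis.2⟩, ?_, ?_⟩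
      · rw [List.forall_mem_cons]
        exact ⟨hkB', fun A hA =>
          (hpos.known A (List.mem_cons_of_mem _ hA)).mono (hIJ.trans hJI')⟩
      · rw [List.forall_mem_cons]
        exact ⟨hstep.1, fun A hA => hpos.admissible A (List.mem_cons_of_mem _ hA)⟩
      · obtain ⟨b, hb⟩ := hpos.common
        rw [List.forall_mem_cons] at hb
        refine ⟨b, List.forall_mem_cons.2 ⟨?_, hb.2⟩⟩
        exact hext.subset_colors (Finset.mem_insert_of_mem hb.1)
    refine ih _ ?_ (B' :: rest) j' I' hpos' rfl ?_
    · have hcard : (covered (B :: rest)).card < (covered (B' :: rest)).card := by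
        rw [card_covered hpos.disjoint, card_covered hpos'.disjoint]
        have := hext.card
        simp only [List.map_cons, List.sum_cons]
        omega
      rw [Finset.card_compl] at hm ⊢
      have := Finset.card_le_univ (covered (B' :: rest))
      omega
    · simp only [totalPotential, List.map_cons, List.sum_cons] at hj ⊢
      omega

/-! ### Monochromatic matchings in a family of trees -/

/-- The number of edges of color `i` in the trees. -/
def colorCount (i : K) (Bs : List (Tree V K)) : ℕ :=
  (Bs.map fun B => (B.N.filter fun x => B.col x = i).card).sum

/-- As the trees are disjoint and properly colored, their edges of color `i` form a matching, here
given as a set of ordered pairs. -/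
theorem Position.exists_matching {I : Set (Sym2 V × K)} {Bs : List (Tree V K)}
    (h : Position I Bs) (i : K) :
    ∃ P : Finset (V × V), P.card = colorCount i Bs ∧
      (∀ p ∈ P, (s(p.1, p.2), i) ∈ I ∧ p.1 ≠ p.2 ∧ p.1 ∈ covered Bs ∧ p.2 ∈ covered Bs) ∧
      ∀ p ∈ P, ∀ q ∈ P, p ≠ q → p.1 ≠ q.1 ∧ p.1 ≠ q.2 ∧ p.2 ≠ q.2 := by
  obtain ⟨hk, hd, -, -⟩ := h
  induction Bs with
  | nil => exact ⟨∅, by simp [colorCount]⟩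
  | cons B Bs ih =>
    rw [List.forall_mem_cons] at hk
    rw [List.pairwise_cons] at hd
    obtain ⟨P, hP1, hP2, hP3⟩ := ih hk.2 hd.2
    have hdis := Finset.disjoint_left.1 (disjoint_covered.2 hd.1)
    let Q : Finset (V × V) := (B.N.filter fun x => B.col x = i).image fun x => (x, B.par x)
    have hQ : ∀ p ∈ Q, p.1 ∈ B.N ∧ B.col p.1 = i ∧ p.2 = B.par p.1 := by
      intro p hp
      obtain ⟨x, hx, rfl⟩ := Finset.mem_image.1 hp
      exact ⟨(Finset.mem_filter.1 hx).1, (Finset.mem_filter.1 hx).2, rfl⟩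
    have hQv : ∀ p ∈ Q, p.1 ∈ B.verts ∧ p.2 ∈ B.verts := by
      intro p hp
      obtain ⟨h1, -, h3⟩ := hQ p hp
      exact ⟨B.mem_verts_of_mem h1, h3 ▸ B.par_mem_verts h1⟩
    have hQcard : Q.card = (B.N.filter fun x => B.col x = i).card :=
      Finset.card_image_of_injective _ fun x y h => (Prod.mk.inj h).1
    have hQP : ∀ p ∈ Q, ∀ q ∈ P, p.1 ≠ q.1 ∧ p.1 ≠ q.2 ∧ p.2 ≠ q.1 ∧ p.2 ≠ q.2 := by
      intro p hp q hq
      have h1 := hQv p hp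
      have h2 := hP2 q hq
      grind
    refine ⟨Q ∪ P, ?_, ?_, ?_⟩
    · rw [Finset.card_union_of_disjoint, hQcard, hP1]
      · simp [colorCount]
      · exact Finset.disjoint_left.2 fun p hp hp' => (hQP p hp p hp').1 rfl
    · intro p hp
      simp only [covered_cons, Finset.mem_union] at hp ⊢
      rcases hp with hp | hp
      · obtain ⟨h1, h2, h3⟩ := hQ p hp
        obtain ⟨h4, h5⟩ := hQv p hp
        refine ⟨?_, ?_, .inl h4, .inl h5⟩
        · rw [h3, ← h2]; exact hk.1 _ h1
        · rw [h3]; exact (B.par_ne h1).symm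
      · obtain ⟨h1, h2, h3, h4⟩ := hP2 p hp
        exact ⟨h1, h2, .inr h3, .inr h4⟩
    · intro p hp q hq hpq
      rw [Finset.mem_union] at hp hq
      rcases hp with hp | hp <;> rcases hq with hq | hq
      · obtain ⟨h1, h2, h3⟩ := hQ p hp
        obtain ⟨g1, g2, g3⟩ := hQ q hq
        have hne : p.1 ≠ q.1 := fun h => hpq (Prod.ext h (by rw [h3, g3, h]))
        have := B.proper _ h1 _ g1 hne (h2.trans g2.symm)
        rw [h3, g3]
        exact ⟨hne, this⟩
      · have := hQP p hp q hq
        grind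
      · have := hQP q hq p hp
        grind
      · exact hP3 p hp q hq hpq

theorem sum_colorCount [Fintype K] (Bs : List (Tree V K)) :
    ∑ i, colorCount i Bs = (Bs.map fun B => B.N.card).sum := by
  induction Bs with
  | nil => simp [colorCount]
  | cons B Bs ih =>
    simp only [colorCount, List.map_cons, List.sum_cons, Finset.sum_add_distrib] at ih ⊢
    rw [ih, ← Finset.card_eq_sum_card_fiberwise fun x _ => Finset.mem_coe.2 (Finset.mem_univ _)]

theorem length_le_colorCount {b : K} {Bs : List (Tree V K)} (h : ∀ B ∈ Bs, b ∈ B.colors) :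
    Bs.length ≤ colorCount b Bs := by
  induction Bs with
  | nil => simp
  | cons B Bs ih =>
    rw [List.forall_mem_cons] at h
    have h1 := ih h.2
    obtain ⟨x, hx, hxb⟩ := Finset.mem_image.1 h.1
    have h2 : 0 < (B.N.filter fun x => B.col x = b).card :=
      Finset.card_pos.2 ⟨x, Finset.mem_filter.2 ⟨hx, hxb⟩⟩
    simp only [colorCount, List.map_cons, List.sum_cons, List.length_cons] at h1 ⊢
    omega

/-- If all vertices but at most one are covered and `m i` is the number of edges of color `i`, then
`n - 1 ≤ ∑ i, m i + m b` for the common color `b`, so `m i < r i` cannot hold for all `i`. -/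
theorem Position.hasMatching {t n : ℕ} {r : Fin t → ℕ} {I : Set (Sym2 (Fin n) × Fin t)}
    {Bs : List (Tree (Fin n) (Fin t))} (h : Position I Bs) (hcov : ((covered Bs)ᶜ).card ≤ 1)
    (hn : ∀ b, ∑ i, (r i - 1) + r b < n) : HasMatching r I := by
  obtain ⟨i, hi⟩ : ∃ i, r i ≤ colorCount i Bs := by
    by_contra! hlt
    obtain ⟨b, hb⟩ := h.common
    have h1 := length_le_colorCount hb
    have h2 := sum_colorCount Bs
    have h3 := card_covered h.disjoint
    have h4 : (Bs.map fun B => B.N.card + 1).sum = (Bs.map fun B => B.N.card).sum + Bs.length := by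
      simp [List.sum_map_add]
    have h5 : ∑ i, colorCount i Bs ≤ ∑ i, (r i - 1) :=
      Finset.sum_le_sum fun i _ => Nat.le_sub_one_of_lt (hlt i)
    have h6 := hn b
    have h7 := hlt b
    rw [Finset.card_compl, Fintype.card_fin] at hcov
    omega
  obtain ⟨P, hP1, hP2, hP3⟩ := h.exists_matching i
  obtain ⟨φ⟩ : Nonempty (Fin (r i) ↪ P) :=
    Function.Embedding.nonempty_of_card_le (by simpa [hP1] using hi)
  refine ⟨i, fun a => if a.2 = 0 then (φ a.1).1.1 else (φ a.1).1.2, ?_, ?_⟩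
  · rintro ⟨a, p⟩ ⟨a', p'⟩ haa
    by_cases h : a = a'
    · subst h
      have := (hP2 _ (φ a).2).2.1
      fin_cases p <;> fin_cases p' <;> simp at haa ⊢
      · exact this haa
      · exact this haa.symm
    · have hne : (φ a).1 ≠ (φ a').1 := fun e => h (φ.injective (Subtype.ext e))
      have h1 := hP3 _ (φ a).2 _ (φ a').2 hne
      have h2 := hP3 _ (φ a').2 _ (φ a).2 hne.symm
      fin_cases p <;> fin_cases p' <;> simp at haa
      · exact absurd haa h1.1
      · exact absurd haa h1.2.1
      · exact absurd haa.symm h2.2.1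
      · exact absurd haa h1.2.2
  · intro a
    simpa using (hP2 _ (φ a).2).1

end OnlineRamsey

theorem mainTheorem1 :
    ∃ C : ℝ, 0 < C ∧
      ∀ (t : ℕ), 2 ≤ t → ∀ (r : Fin t → ℕ), (∀ i, 0 < r i) → ∀ (n : ℕ),
        OnlineRamsey.ramseyNumber (fun i => OnlineRamsey.matching (r i)) ≤ (n : ℕ∞) →
        ∃ ℓ : ℕ,
          OnlineRamsey.restrictedOnlineRamseyNumber
            (fun i => OnlineRamsey.matching (r i)) n = (ℓ : ℕ∞) ∧
          (ℓ : ℝ) ≤ OnlineRamsey.matchingConstant t * (n : ℝ) ∧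
          OnlineRamsey.matchingConstant t * (n : ℝ) ≤ C * ((n : ℝ) * Real.log (t : ℝ)) := by
  open OnlineRamsey in
  classical
  refine ⟨3 / Real.log 2, div_pos (by norm_num) (Real.log_pos (by norm_num)), ?_⟩
  intro t ht r hr n hn
  have hlow := lt_of_ramseyNumber_le hr hn
  have hpos : Position (∅ : Set (Sym2 (Fin n) × Fin t)) [] :=
    ⟨by simp, by simp, by simp, ⟨⟨0, by omega⟩, by simp⟩⟩
  have hwin : BuilderCanWin (fun i => matching (r i)) n ⌊matchingConstant t * (n : ℝ)⌋₊ := by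
    refine builderCanWin_of_reach ((Position.reach _ [] 0 ∅ hpos rfl (Nat.zero_le _)).bind ?_)
    rintro j I - ⟨Bs, hBs, hcov, hj⟩
    refine .done ⟨Nat.le_floor ?_, hBs.hasMatching hcov hlow⟩
    have h1 := totalPotential_le (by simpa using ht) hBs
    rw [Fintype.card_fin] at h1 hj
    rw [Fintype.card_fin] at h1
    exact le_trans (by exact_mod_cast hj) h1
  have hC := matchingConstant_le ht
  have hC1 := one_le_matchingConstant ht
  have hex : ∃ ℓ, BuilderCanWin (fun i => matching (r i)) n ℓ := ⟨_, hwin⟩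
  refine ⟨Nat.find hex, le_antisymm (iInf₂_le _ (Nat.find_spec hex)) (le_iInf₂ fun ℓ hℓ => ?_),
    ?_, ?_⟩
  · exact_mod_cast Nat.find_min' hex hℓ
  · refine le_trans ?_ (Nat.floor_le (by positivity))
    exact_mod_cast Nat.find_min' hex hwin
  · calc matchingConstant t * (n : ℝ) ≤ 3 / Real.log 2 * Real.log t * n := by gcongr
      _ = 3 / Real.log 2 * (n * Real.log t) := by ring
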